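/- Let $k>1$ be an integer. For finite words $u,v$ over $\{0,1\}$ write $u\sim_k v$ if every nonempty word of length at most $k$ occurs equally often as a factor in $u$ and in $v$. A *$k$-abelian power of exponent $n\ge 2$ and period $m$* is a concatenation $u_0u_1\cdots u_{n-1}$ of words of length $m$ with $u_i\sim_k u_j$ for all $i,j$. For irrational $\alpha$, a *Sturmian word of slope $\alpha$* is an infinite word whose $n$-th letter ($n\ge 0$) is $0$ if $\{x+n\alpha\}\in I_0$ and $1$ if $\{x+n\alpha\}\in I_1$, for some $x\in[0,1)$, where $\{\cdot\}$ denotes the fractional part and either $I_0=[0,\{1-\alpha\})$, $I_1=[\{1-\alpha\},1)$, or $I_0=(0,\{1-\alpha\}]$, $I_1=(\{1-\alpha\},1]$ with the points $0$ and $1$ identified. Let $\mathcal{A}_{k,\alpha}(m)$ be the maximum exponent of a $k$-abelian power of period $m$ occurring as a factor in a Sturmian word of slope $\alpha$ (set to $0$ if there is none), let $$\mathcal{A}_k(\alpha)=\limsup_{m\to\infty}\frac{\mathcal{A}_{k,\alpha}(m)}{m}\in[0,\infty],$$ and define the *$k$-Lagrange spectrum* as $\mathcal{L}_k=\{\mathcal{A}_k(\alpha):\alpha\in\mathbb{R}\setminus\mathbb{Q}\}\cap\mathbb{R}$.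 **Theorem.** For every integer $k>1$, the $k$-Lagrange spectrum $\mathcal{L}_k$ is dense in the interval $\left(\frac{\sqrt5}{2k-1},\infty\right)$; that is, every point of this interval is a limit of points of $\mathcal{L}_k$ lying in this interval. -/

import Mathlib

/-- The number of occurrences of the word `w` as a factor of the finite word `u`, that is, the
number of positions `i` of `u` at which `w` begins. -/
def occurrences {A : Type} [DecidableEq A] (u w : List A) : ℕ :=
  ((Finset.range u.length).filter (fun i => w <+: u.drop i)).card

/-- `u` and `v` are `k`-abelian equivalent: every nonempty word of length at most `k` occurs
equally often in both. -/
def KAbelianEquiv {A : Type} [DecidableEq A] (k : ℕ) (u v : List A) : Prop :=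
  ∀ w : List A, w ≠ [] → w.length ≤ k → occurrences u w = occurrences v w

/-- `p` is a (nondegenerate) `k`-abelian power of exponent `n` and period `m`: the concatenation
of `n ≥ 2` pairwise `k`-abelian equivalent words of length `m`. -/
def IsKAbelianPower {A : Type} [DecidableEq A] (k n m : ℕ) (p : List A) : Prop :=
  2 ≤ n ∧ ∃ l : List (List A), l.length = n ∧ (∀ u ∈ l, u.length = m) ∧
    (∀ u ∈ l, ∀ v ∈ l, KAbelianEquiv k u v) ∧ p = l.flatten

/-- The finite word `p` occurs in the infinite word `s` (it is a factor of `s`). -/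
def OccursIn {A : Type} (p : List A) (s : ℕ → A) : Prop :=
  ∃ i : ℕ, p = (List.range p.length).map (fun j => s (i + j))

/-- The Sturmian word of slope `α` and intercept `x`, with the endpoint convention
`I₀ = [0, {1 - α})`, `I₁ = [{1 - α}, 1)`. Its `n`-th letter codes the point
`Rⁿ(x) = {x + n α}` of the circle `[0, 1)`. -/
noncomputable def sturmianLower (α x : ℝ) (n : ℕ) : Fin 2 :=
  if Int.fract (x + n * α) < Int.fract (1 - α) then 0 else 1

/-- The Sturmian word of slope `α` and intercept `x`, with the endpoint convention
`I₀ = (0, {1 - α}]`, `I₁ = ({1 - α}, 1]`, where the point `1` of the circle is the point `0`. -/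
noncomputable def sturmianUpper (α x : ℝ) (n : ℕ) : Fin 2 :=
  if 0 < Int.fract (x + n * α) ∧ Int.fract (x + n * α) ≤ Int.fract (1 - α) then 0 else 1

/-- `s` is a Sturmian word of slope `α` (used for irrational `α`). -/
def IsSturmianOfSlope (α : ℝ) (s : ℕ → Fin 2) : Prop :=
  ∃ x ∈ Set.Ico (0 : ℝ) 1, s = sturmianLower α x ∨ s = sturmianUpper α x

/-- The maximum exponent of `k`-abelian powers of period `m` occurring in a Sturmian word of
slope `α`, as a supremum in `ℕ ∪ {∞}` (it is `0` when no such power occurs). -/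
noncomputable def maxExponent (k : ℕ) (α : ℝ) (m : ℕ) : ℕ∞ :=
  sSup {e : ℕ∞ | ∃ n : ℕ, e = n ∧ ∃ s : ℕ → Fin 2, IsSturmianOfSlope α s ∧
    ∃ p : List (Fin 2), IsKAbelianPower k n m p ∧ OccursIn p s}

/-- The `k`-abelian critical exponent of slope `α`, with values in `[0, ∞]`. -/
noncomputable def criticalExponent (k : ℕ) (α : ℝ) : ENNReal :=
  Filter.limsup (fun m : ℕ => (maxExponent k α m : ENNReal) / (m : ENNReal)) Filter.atTop

/-- The `k`-Lagrange spectrum: the set of the finite `k`-abelian critical exponents of irrational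
slopes, as a set of real numbers. -/
def kLagrangeSpectrum (k : ℕ) : Set ℝ :=
  {y : ℝ | ∃ α : ℝ, Irrational α ∧ criticalExponent k α ≠ ⊤ ∧ (criticalExponent k α).toReal = y}

/-! The proof computes the critical exponent for small slopes, `0 < α` and `(2k - 1)α ≤ 1`. Then two
letters 1 never lie in a common window of length `k`, so `k`-abelian equivalence is governed by the
counting function `F` of the letter 1 near the ends of the blocks. The circle points at the block
boundaries of a power form an arithmetic progression with difference `mα - r`. For a long power they
are confined, up to the two extreme ones, to an interval of length at most `1 - (2k - 2)α`
(`CountsSparse.exponent_mul_le`), and an interval of that length can be used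
(`exists_kAbelianPower`). If `μ` is the lower limit of `m‖mα‖`, where `‖·‖` is the distance to the
nearest integer, the critical exponent is therefore `(1 - (2k - 2)α) / μ` (`criticalExponent_eq`).

For each `N ≥ 1` the slopes with `μ = 1 / √(N² + 4)` are dense (`exists_slope`): they are unimodular
images of the root `θ = [0; N, N, ...]` of `θ² + Nθ = 1`. With `w = √(N² + 4)`, letting `α` range
over `(0, 1/(2k - 1))` gives values dense in `(w/(2k - 1), w)`. These intervals overlap for
successive `N` because `2k - 1 ≥ 3`, and together they cover `(√5/(2k - 1), ∞)`. -/

/-- The factor of length `m` of the infinite word `s` that begins at position `p`. -/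
def block {A : Type} (s : ℕ → A) (p m : ℕ) : List A :=
  (List.range m).map fun j => s (p + j)

/-! ### Factors of an infinite word and occurrences inside them. -/

section Blocks

variable {A : Type}

@[simp] lemma length_block (s : ℕ → A) (p m : ℕ) : (block s p m).length = m := by
  simp [block]

lemma block_append (s : ℕ → A) (p m n : ℕ) :
    block s p (m + n) = block s p m ++ block s (p + m) n := by
  simp [block, List.range_add, Function.comp_def, add_assoc]

lemma flatten_map_block (s : ℕ → A) (p m n : ℕ) :
    ((List.range n).map fun j => block s (p + j * m) m).flatten = block s p (n * m) := by
  induction n with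
  | zero => simp [block]
  | succ n ih => rw [List.range_succ, List.map_append, List.flatten_append, ih, add_mul, one_mul,
      block_append]; simp

lemma getElem_eq_block_of_flatten (s : ℕ → A) (m : ℕ) (l : List (List A)) (p : ℕ)
    (hm : ∀ u ∈ l, u.length = m) (h : l.flatten = block s p l.flatten.length) (j : ℕ)
    (hj : j < l.length) : l[j] = block s (p + j * m) m := by
  induction l generalizing p j with
  | nil => simp at hj
  | cons u l ih =>
    rw [List.flatten_cons, List.length_append, block_append, hm u (by simp)] at h
    obtain ⟨h1, h2⟩ := List.append_inj h (by simp [hm u (by simp)])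
    cases j with
    | zero => simpa using h1
    | succ j =>
      have := ih (p + m) (fun v hv => hm v (by simp [hv])) h2 j (by simpa using hj)
      simpa [add_mul, add_assoc, add_comm, add_left_comm] using this

lemma prefix_drop_block_iff (s : ℕ → A) (p m i : ℕ) (w : List A) (hi : i < m) :
    w <+: (block s p m).drop i ↔
      i + w.length ≤ m ∧ ∀ t (ht : t < w.length), w[t] = s (p + i + t) := by
  rw [List.prefix_iff_getElem]
  constructor
  · rintro ⟨h, h'⟩
    simp only [List.length_drop, length_block] at h
    refine ⟨by omega, fun t ht => ?_⟩
    have := h' t ht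
    simpa [block, add_assoc] using this
  · rintro ⟨h, h'⟩
    refine ⟨by simp; omega, fun t ht => ?_⟩
    have := h' t ht
    simpa [block, add_assoc] using this

/-- An occurrence of a nonempty word in a block is a position of the infinite word. -/
lemma occurrences_block [DecidableEq A] (s : ℕ → A) (p m : ℕ) (w : List A) (hw : w ≠ [])
    (hm : w.length ≤ m) :
    occurrences (block s p m) w = ((Finset.range (m + 1 - w.length)).filter
      fun i => ∀ t : Fin w.length, w[t] = s (p + i + t)).card := by
  unfold occurrences
  have hw' := List.length_pos_of_ne_nil hw
  congr 1
  ext i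
  simp only [Finset.mem_filter, Finset.mem_range, length_block]
  constructor
  · rintro ⟨hi, h⟩
    rw [prefix_drop_block_iff s p m i w hi] at h
    exact ⟨by omega, fun t => h.2 t t.2⟩
  · rintro ⟨hi, h⟩
    refine ⟨by omega, ?_⟩
    rw [prefix_drop_block_iff s p m i w (by omega)]
    exact ⟨by omega, fun t ht => h ⟨t, ht⟩⟩

end Blocks

/-! ### Abelian equivalence of blocks in words with isolated letters 1. -/

/-- `F` counts the letters `1` of the binary word `s`, and no factor of length `k` of `s`
contains the letter `1` twice. -/
structure CountsSparse (k : ℕ) (s : ℕ → Fin 2) (F : ℕ → ℤ) : Prop where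
  step : ∀ n, F (n + 1) = F n + ((s n : ℕ) : ℤ)
  sparse : ∀ n, F (n + k) ≤ F n + 1

namespace CountsSparse

variable {k : ℕ} {s : ℕ → Fin 2} {F : ℕ → ℤ}

lemma sum_eq (h : CountsSparse k s F) (p n : ℕ) :
    ∑ i ∈ Finset.range n, ((s (p + i) : ℕ) : ℤ) = F (p + n) - F p := by
  induction n with
  | zero => simp
  | succ n ih => rw [Finset.sum_range_succ, ih, ← add_assoc, h.step]; ring

lemma mono (h : CountsSparse k s F) : Monotone F :=
  monotone_nat_of_le_succ fun n => by rw [h.step]; omega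

lemma window_le (h : CountsSparse k s F) (n j : ℕ) (hj : j ≤ k) : F (n + j) ≤ F n + 1 :=
  (h.mono (by omega)).trans (h.sparse n)

lemma unique_one (h : CountsSparse k s F) (n t t' : ℕ) (ht : t < k) (ht' : t' < k)
    (h1 : s (n + t) = 1) (h1' : s (n + t') = 1) : t = t' := by
  by_contra hne
  wlog hlt : t < t' generalizing t t'
  · exact this t' t ht' ht h1' h1 (Ne.symm hne) (by omega)
  have e1 := h.step (n + t)
  have e2 := h.step (n + t')
  rw [h1] at e1
  rw [h1'] at e2
  have a1 : F n ≤ F (n + t) := h.mono (by omega)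
  have a2 : F (n + t + 1) ≤ F (n + t') := h.mono (by omega)
  have a3 := h.window_le n (t' + 1) (by omega)
  rw [← add_assoc] at a3
  simp at e1 e2
  omega

/-- Occurrences of a word with exactly one letter `1`, at position `a`. -/
lemma occurrences_one (h : CountsSparse k s F) (p m : ℕ) (w : List (Fin 2)) (hk : w.length ≤ k)
    (hm : w.length ≤ m) (a : ℕ) (ha : a < w.length)
    (hw : ∀ t (ht : t < w.length), w[t] = 1 ↔ t = a) :
    (occurrences (block s p m) w : ℤ) = F (p + m + 1 + a - w.length) - F (p + a) := by
  have hne : w ≠ [] := by rintro rfl; simp at ha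
  rw [occurrences_block s p m w hne hm, Finset.card_filter, Nat.cast_sum]
  have e : p + m + 1 + a - w.length = p + a + (m + 1 - w.length) := by omega
  rw [e, ← h.sum_eq]
  refine Finset.sum_congr rfl fun i _ => ?_
  rw [show p + a + i = p + i + a by omega]
  -- By sparsity a 1 at offset `a` forces zeros in the rest of the window, so matching `w` is a
  -- condition on one letter.
  have hA : (∀ t : Fin w.length, w[t] = s (p + i + t)) ↔ s (p + i + a) = 1 := by
    constructor
    · intro H
      have := H ⟨a, ha⟩
      simp only [Fin.getElem_fin] at this
      rw [← this, hw a ha]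
    · intro H t
      have := hw t t.2
      simp only [Fin.getElem_fin]
      by_cases hta : (t : ℕ) = a
      · rw [this.2 hta, hta, H]
      · have h1 : s (p + i + t) ≠ 1 := fun hc =>
          hta (h.unique_one (p + i) t a (by omega) (by omega) hc H)
        have h2 : w[(t : ℕ)] ≠ 1 := fun hc => hta (this.1 hc)
        omega
  simp only [hA]
  split_ifs with h1
  · simp [h1]
  · have : s (p + i + a) = 0 := by omega
    simp [this]

/-- Occurrences of a word without the letter `1`. -/
lemma occurrences_zero (h : CountsSparse k s F) (p m : ℕ) (w : List (Fin 2)) (hk : w.length ≤ k)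
    (hm : w.length ≤ m) (hne : w ≠ [])
    (hw : ∀ t (ht : t < w.length), w[t] = 0) :
    (occurrences (block s p m) w : ℤ) = (m + 1 - w.length : ℕ) -
      ∑ t ∈ Finset.range w.length, (F (p + t + (m + 1 - w.length)) - F (p + t)) := by
  rw [occurrences_block s p m w hne hm, Finset.card_filter, Nat.cast_sum]
  simp only [← h.sum_eq]
  -- A window holds at most one letter 1, so the indicator of "no 1" is one minus the number of 1s
  -- in it. Exchanging the sums regroups these numbers by window.
  rw [Finset.sum_comm]
  have : ((m + 1 - w.length : ℕ) : ℤ) = ∑ i ∈ Finset.range (m + 1 - w.length), 1 := by simp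
  rw [this, ← Finset.sum_sub_distrib]
  refine Finset.sum_congr rfl fun i _ => ?_
  have e : ∑ t ∈ Finset.range w.length, ((s (p + t + i) : ℕ) : ℤ) =
      F (p + i + w.length) - F (p + i) := by
    rw [← h.sum_eq]
    refine Finset.sum_congr rfl fun t _ => ?_
    rw [add_right_comm]
  rw [e]
  have hle := h.window_le (p + i) _ hk
  have hge : F (p + i) ≤ F (p + i + w.length) := h.mono (by omega)
  have hA : (∀ t : Fin w.length, w[t] = s (p + i + t)) ↔
      F (p + i + w.length) - F (p + i) = 0 := by
    rw [← h.sum_eq, Finset.sum_eq_zero_iff_of_nonneg (fun _ _ => by positivity)]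
    constructor
    · intro H t ht
      have := H ⟨t, by simpa using ht⟩
      simp only [Fin.getElem_fin] at this
      rw [← this, hw]; rfl
    · intro H t
      have := H t (by simp)
      simp only [Fin.getElem_fin]
      rw [hw]
      omega
  simp only [hA]
  split_ifs with h1
  · simp [h1]
  · push_cast; omega

lemma occurrences_two (h : CountsSparse k s F) (p m : ℕ) (w : List (Fin 2)) (hk : w.length ≤ k)
    (hm : w.length ≤ m) (a b : ℕ) (ha : a < w.length) (hb : b < w.length) (hab : a ≠ b)
    (hwa : w[a] = 1) (hwb : w[b] = 1) : occurrences (block s p m) w = 0 := by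
  have hne : w ≠ [] := by rintro rfl; simp at ha
  rw [occurrences_block s p m w hne hm, Finset.card_eq_zero, Finset.filter_eq_empty_iff]
  intro i _ H
  have h1 := H ⟨a, ha⟩
  have h2 := H ⟨b, hb⟩
  simp only [Fin.getElem_fin] at h1 h2
  exact hab (h.unique_one (p + i) a b (by omega) (by omega) (h1 ▸ hwa) (h2 ▸ hwb))

/-- Two blocks whose ends are far from the letter `1` are `k`-abelian equivalent if they contain
equally many letters `1`. -/
lemma kAbelianEquiv_block (h : CountsSparse k s F) (p q m : ℕ) (hkm : k ≤ m)
    (hp : ∀ t < k, F (p + t) = F p) (hp' : ∀ t < k, F (p + m - t) = F (p + m))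
    (hq : ∀ t < k, F (q + t) = F q) (hq' : ∀ t < k, F (q + m - t) = F (q + m))
    (hpq : F (p + m) - F p = F (q + m) - F q) :
    KAbelianEquiv k (block s p m) (block s q m) := by
  intro w hne hk
  have hpos := List.length_pos_of_ne_nil hne
  by_cases h0 : ∀ t (ht : t < w.length), w[t] = 0
  · have := h.occurrences_zero p m w hk (hk.trans hkm) hne h0
    have := h.occurrences_zero q m w hk (hk.trans hkm) hne h0
    have e : ∑ t ∈ Finset.range w.length, (F (p + t + (m + 1 - w.length)) - F (p + t)) =
        ∑ t ∈ Finset.range w.length, (F (q + t + (m + 1 - w.length)) - F (q + t)) := by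
      refine Finset.sum_congr rfl fun t ht => ?_
      have ht := Finset.mem_range.1 ht
      rw [hp t (by omega), hq t (by omega),
        show p + t + (m + 1 - w.length) = p + m - (w.length - 1 - t) by omega,
        show q + t + (m + 1 - w.length) = q + m - (w.length - 1 - t) by omega,
        hp' _ (by omega), hq' _ (by omega), hpq]
    omega
  · push Not at h0
    obtain ⟨a, ha, hwa⟩ := h0
    have hwa : w[a] = 1 := by omega
    by_cases h1 : ∃ b, ∃ hb : b < w.length, a ≠ b ∧ w[b] = 1
    · obtain ⟨b, hb, hab, hwb⟩ := h1
      rw [h.occurrences_two p m w hk (hk.trans hkm) a b ha hb hab hwa hwb,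
        h.occurrences_two q m w hk (hk.trans hkm) a b ha hb hab hwa hwb]
    · push Not at h1
      have hw : ∀ t (ht : t < w.length), w[t] = 1 ↔ t = a := by
        intro t ht
        refine ⟨fun h2 => ?_, ?_⟩
        · by_contra h3
          exact h1 t ht (Ne.symm h3) h2
        · rintro rfl; exact hwa
      have e1 := h.occurrences_one p m w hk (hk.trans hkm) a ha hw
      have e2 := h.occurrences_one q m w hk (hk.trans hkm) a ha hw
      rw [show p + m + 1 + a - w.length = p + m - (w.length - 1 - a) by omega,
        hp' _ (by omega), hp a (by omega)] at e1
      rw [show q + m + 1 + a - w.length = q + m - (w.length - 1 - a) by omega,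
        hq' _ (by omega), hq a (by omega)] at e2
      omega

/-- The numbers of letters `1` in the blocks and in their short prefixes and suffixes are
invariants of `k`-abelian equivalence. -/
lemma eq_of_kAbelianEquiv (h : CountsSparse k s F) (p q m : ℕ) (hkm : k ≤ m)
    (he : KAbelianEquiv k (block s p m) (block s q m)) (a b : ℕ) (hab : a + b < k) :
    F (p + m - b) - F (p + a) = F (q + m - b) - F (q + a) := by
  set w : List (Fin 2) := (List.range (a + b + 1)).map fun t => if t = a then 1 else 0 with hw
  have hl : w.length = a + b + 1 := by simp [hw]
  have hw1 : ∀ t (ht : t < w.length), w[t] = 1 ↔ t = a := by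
    intro t ht
    simp [hw]
  have e := he w (by intro hc; simp [hc] at hl) (by omega)
  have e1 := h.occurrences_one p m w (by omega) (by omega) a (by omega) hw1
  have e2 := h.occurrences_one q m w (by omega) (by omega) a (by omega) hw1
  rw [hl, show p + m + 1 + a - (a + b + 1) = p + m - b by omega] at e1
  rw [hl, show q + m + 1 + a - (a + b + 1) = q + m - b by omega] at e2
  omega

end CountsSparse

/-! ### Sturmian words of small slope: powers as arithmetic progressions on the circle. -/

section Slopes

variable {k : ℕ} {α : ℝ}

lemma floor_mul_sub_le (hk : (k : ℝ) * α ≤ 1) (y : ℝ) : ⌊y + k * α⌋ ≤ ⌊y⌋ + 1 := by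
  rw [← Int.floor_add_one]
  exact Int.floor_le_floor (by linarith)

lemma countsSparse_sturmianLower (h0 : 0 < α) (h1 : α < 1) (hk : (k : ℝ) * α ≤ 1) (x : ℝ) :
    CountsSparse k (sturmianLower α x) fun n => ⌊x + n * α⌋ where
  step n := by
    have hf : Int.fract (1 - α) = 1 - α := Int.fract_eq_self.2 ⟨by linarith, by linarith⟩
    have e := Int.floor_add_fract (x + n * α)
    have e0 := Int.fract_nonneg (x + n * α)
    have e1 := Int.fract_lt_one (x + n * α)
    simp only [sturmianLower, hf]
    rw [Int.floor_eq_iff]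
    split_ifs with h <;> push_cast <;> constructor <;> simp <;> linarith
  sparse n := by
    have := floor_mul_sub_le hk (x + n * α)
    simpa [add_mul, add_assoc] using this

/-- For this convention the circle is `(0, 1]`, so the integer part of `y` is `⌈y⌉ - 1`; an integer
`y` represents the point 1 and carries the letter 1. -/
lemma countsSparse_sturmianUpper (h0 : 0 < α) (h1 : α < 1) (hk : (k : ℝ) * α ≤ 1) (x : ℝ) :
    CountsSparse k (sturmianUpper α x) fun n => ⌈x + n * α⌉ - 1 where
  step n := by
    have hf : Int.fract (1 - α) = 1 - α := Int.fract_eq_self.2 ⟨by linarith, by linarith⟩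
    have e := Int.floor_add_fract (x + n * α)
    have e0 := Int.fract_nonneg (x + n * α)
    have e1 := Int.fract_lt_one (x + n * α)
    simp only [sturmianUpper, hf]
    rcases e0.eq_or_lt with hz | hz
    · have hc : ⌈x + n * α⌉ = ⌊x + n * α⌋ := by
        rw [Int.ceil_eq_iff]; constructor <;> linarith
      have : ⌈x + ((n + 1 : ℕ) : ℝ) * α⌉ = ⌊x + n * α⌋ + 1 := by
        rw [Int.ceil_eq_iff]; push_cast; constructor <;> linarith
      rw [hc, this, if_neg (fun H => H.1.ne hz)]
      simp
    · have hc : ⌈x + n * α⌉ = ⌊x + n * α⌋ + 1 := by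
        rw [Int.ceil_eq_iff]; push_cast; constructor <;> linarith
      rw [hc]
      split_ifs with h
      · have : ⌈x + ((n + 1 : ℕ) : ℝ) * α⌉ = ⌊x + n * α⌋ + 1 := by
          rw [Int.ceil_eq_iff]; push_cast; constructor <;> linarith [h.2]
        rw [this]; simp
      · have h' : 1 - α < Int.fract (x + n * α) := by
          by_contra hc'; exact h ⟨hz, not_lt.1 hc'⟩
        have : ⌈x + ((n + 1 : ℕ) : ℝ) * α⌉ = ⌊x + n * α⌋ + 2 := by
          rw [Int.ceil_eq_iff]; push_cast; constructor <;> linarith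
        rw [this]; simp; ring
  sparse n := by
    have : ⌈x + n * α + k * α⌉ ≤ ⌈x + n * α⌉ + 1 := by
      rw [← Int.ceil_add_one]
      exact Int.ceil_le_ceil (by linarith)
    have e : x + ((n + k : ℕ) : ℝ) * α = x + n * α + k * α := by push_cast; ring
    rw [e]; omega

/-- The closed bounds `0` and `1` hold for both endpoint conventions, so the upper estimate on
exponents can treat them together. -/
lemma exists_countsSparse (h0 : 0 < α) (h1 : α < 1) (hk : (k : ℝ) * α ≤ 1) {s : ℕ → Fin 2}
    (hs : IsSturmianOfSlope α s) :
    ∃ x F, CountsSparse k s F ∧ ∀ n : ℕ, 0 ≤ x + n * α - F n ∧ x + n * α - F n ≤ 1 := by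
  obtain ⟨x, -, rfl | rfl⟩ := hs
  · refine ⟨x, _, countsSparse_sturmianLower h0 h1 hk x, fun n => ?_⟩
    have e := Int.floor_le (x + n * α)
    have e1 := Int.lt_floor_add_one (x + n * α)
    constructor <;> linarith
  · refine ⟨x, _, countsSparse_sturmianUpper h0 h1 hk x, fun n => ?_⟩
    have e := Int.le_ceil (x + n * α)
    have e1 := Int.ceil_lt_add_one (x + n * α)
    push_cast
    constructor <;> linarith

/-- The ends of the blocks of a `k`-abelian power, apart from the two extreme ones, form an
arithmetic progression in an interval of length `1 - (2k - 2)α`. -/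
lemma CountsSparse.exponent_mul_le {s : ℕ → Fin 2} {F : ℕ → ℤ} {x : ℝ}
    (h : CountsSparse k s F) (hk : 1 < k) (hα : (2 * k - 1 : ℝ) * α ≤ 1)
    (hF : ∀ n : ℕ, 0 ≤ x + n * α - F n ∧ x + n * α - F n ≤ 1)
    {n m : ℕ} {p : List (Fin 2)} (hkm : k ≤ m) (hp : IsKAbelianPower k n m p)
    (ho : OccursIn p s) :
    ∃ r : ℤ, ((n : ℝ) - 2) * |m * α - r| ≤ 1 - (2 * k - 2) * α := by
  obtain ⟨hn, l, rfl, hlen, heq, rfl⟩ := hp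
  obtain ⟨i, hi⟩ := ho
  set n := l.length with hn'
  set P : ℕ → ℕ := fun j => i + j * m with hP
  have hPs : ∀ j, P j + m = P (j + 1) := fun j => by simp only [hP]; ring
  have hb : ∀ j (hj : j < n), l[j] = block s (P j) m := fun j hj =>
    getElem_eq_block_of_flatten s m l i hlen hi j hj
  have he : ∀ j < n, KAbelianEquiv k (block s (P j) m) (block s (P 0) m) := fun j hj => by
    rw [← hb j hj, ← hb 0 (by omega)]
    exact heq _ (List.getElem_mem _) _ (List.getElem_mem _)
  have key := fun j (hj : j < n) => h.eq_of_kAbelianEquiv (P j) (P 0) m hkm (he j hj)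
  set r := F (P 0 + m) - F (P 0) with hr
  have hstep : ∀ j < n, F (P j + m) = F (P j) + r := fun j hj => by
    have := key j hj 0 0 (by omega)
    simp only [Nat.sub_zero, Nat.add_zero] at this
    omega
  have hpre : ∀ a < k, ∀ j < n, F (P j + a) - F (P j) = F (P 0 + a) - F (P 0) := by
    intro a ha j hj
    have := key j hj a 0 (by omega)
    have := hstep j hj
    simp only [Nat.sub_zero] at *
    omega
  have hsuf : ∀ b < k, ∀ j < n,
      F (P j + m) - F (P j + m - b) = F (P 0 + m) - F (P 0 + m - b) := by
    intro b hb j hj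
    have := key j hj 0 b (by omega)
    have := hstep j hj
    simp only [Nat.add_zero] at *
    omega
  set θ : ℕ → ℝ := fun j => x + P j * α - F (P j) with hθ
  have hap : ∀ j ≤ n, θ j = θ 0 + j * (m * α - r) := by
    intro j
    induction j with
    | zero => simp
    | succ j ih =>
      intro hj
      have e : θ (j + 1) = θ j + (m * α - r) := by
        simp only [hθ, ← hPs, hstep j (by omega)]; push_cast; ring
      rw [e, ih (by omega)]; push_cast; ring
  have hadd : ∀ j a, x + (P j + a : ℕ) * α - F (P j + a) =
      θ j + a * α - (F (P j + a) - F (P j) : ℤ) := by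
    intro j a; simp only [hθ]; push_cast; ring
  have hsub : ∀ j b, b ≤ m → x + (P j + m - b : ℕ) * α - F (P j + m - b) =
      θ (j + 1) - b * α + (F (P j + m) - F (P j + m - b) : ℤ) := by
    intro j b hb; simp only [hθ, ← hPs]; rw [Nat.cast_sub (by omega)]; push_cast; ring
  have hk1 : ((k - 1 : ℕ) : ℝ) = k - 1 := by rw [Nat.cast_sub hk.le]; simp
  -- If some block has a 1 near its start or its end, all blocks have it at the same offset, which
  -- pins the boundary points to an interval of length `α`; this is where `(2k - 1)α ≤ 1` enters.
  -- Otherwise no boundary point comes within `(k - 1)α` of `0` or `1`. The last case uses the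
  -- blocks on both sides of a boundary, hence only interior boundaries.
  have hI : ∃ u v : ℝ, v - u ≤ 1 - (2 * k - 2) * α ∧ ∀ j, j + 1 < n → u ≤ θ (j + 1) ∧
      θ (j + 1) ≤ v := by
    by_cases hc : ∃ a, a < k ∧ F (P 0 + a) - F (P 0) ≠ 0
    · classical
      obtain ⟨ha, ha'⟩ := Nat.find_spec hc
      have hmin := fun b => Nat.find_min hc (m := b)
      set a := Nat.find hc
      have ha0 : a ≠ 0 := fun hz => by simp [hz] at ha'
      obtain ⟨a', hsa⟩ := Nat.exists_eq_succ_of_ne_zero ha0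
      have hz : F (P 0 + a') - F (P 0) = 0 := by
        by_contra hne; exact hmin a' (by omega) ⟨by omega, hne⟩
      have hpos : (1 : ℤ) ≤ F (P 0 + a) - F (P 0) := by
        have := h.mono (show P 0 ≤ P 0 + a by omega); omega
      refine ⟨1 - a * α, 1 - a' * α, by rw [hsa]; push_cast; linarith, fun j hj => ?_⟩
      have h1 := (hF (P (j + 1) + a)).1
      have h2 := (hF (P (j + 1) + a')).2
      rw [hadd, hpre a ha _ hj] at h1
      rw [hadd, hpre a' (by omega) _ hj, hz] at h2
      have : (1 : ℝ) ≤ (F (P 0 + a) - F (P 0) : ℤ) := by exact_mod_cast hpos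
      push_cast at *
      constructor <;> linarith
    by_cases hd : ∃ b, b < k ∧ F (P 0 + m) - F (P 0 + m - b) ≠ 0
    · classical
      obtain ⟨ha, ha'⟩ := Nat.find_spec hd
      have hmin := fun b => Nat.find_min hd (m := b)
      set a := Nat.find hd
      have ha0 : a ≠ 0 := fun hz => by simp [hz] at ha'
      obtain ⟨a', hsa⟩ := Nat.exists_eq_succ_of_ne_zero ha0
      have hz : F (P 0 + m) - F (P 0 + m - a') = 0 := by
        by_contra hne; exact hmin a' (by omega) ⟨by omega, hne⟩
      have hpos : (1 : ℤ) ≤ F (P 0 + m) - F (P 0 + m - a) := by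
        have := h.mono (show P 0 + m - a ≤ P 0 + m by omega); omega
      refine ⟨a' * α, a * α, by rw [hsa]; push_cast; linarith, fun j hj => ?_⟩
      have h1 := (hF (P j + m - a)).2
      have h2 := (hF (P j + m - a')).1
      rw [hsub _ _ (by omega), hsuf a ha _ (by omega)] at h1
      rw [hsub _ _ (by omega), hsuf a' (by omega) _ (by omega), hz] at h2
      have : (1 : ℝ) ≤ (F (P 0 + m) - F (P 0 + m - a) : ℤ) := by exact_mod_cast hpos
      push_cast at *
      constructor <;> linarith
    · push Not at hc hd
      refine ⟨(k - 1) * α, 1 - (k - 1) * α, by linarith, fun j hj => ?_⟩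
      have h1 := (hF (P (j + 1) + (k - 1))).2
      have h2 := (hF (P j + m - (k - 1))).1
      rw [hadd, hpre _ (by omega) _ hj, hc _ (by omega), hk1] at h1
      rw [hsub _ _ (by omega), hsuf _ (by omega) _ (by omega), hd _ (by omega), hk1] at h2
      push_cast at h1 h2
      constructor <;> linarith
  obtain ⟨u, v, huv, hI⟩ := hI
  refine ⟨r, ?_⟩
  rcases hn.eq_or_lt with h2 | h2
  · rw [← h2]
    have := hI 0 (by omega)
    norm_num
    linarith
  -- The first and last interior boundaries, `θ 1` and `θ (n - 1)`, are `n - 2` steps apart.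
  have a1 := hI 0 (by omega)
  have a2 := hI (n - 2) (by omega)
  have hc : ((n - 2 + 1 : ℕ) : ℝ) = (n : ℝ) - 1 := by
    rw [show n - 2 + 1 = n - 1 by omega, Nat.cast_sub (by omega)]; simp
  rw [hap _ (by omega)] at a1 a2
  rw [hc] at a2
  push_cast at a1
  have hn2 : (0 : ℝ) ≤ (n : ℝ) - 2 := by
    have : (2 : ℝ) ≤ n := by exact_mod_cast hn
    linarith
  rw [← abs_of_nonneg hn2, ← abs_mul, abs_le]
  constructor <;> linarith

/-- A long enough free interval accommodates a `k`-abelian power. -/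
lemma exists_kAbelianPower (h0 : 0 < α) (hk : 1 < k) (hα : (2 * k - 1 : ℝ) * α ≤ 1)
    {n m : ℕ} (hn : 2 ≤ n) (hkm : k ≤ m) (r : ℤ)
    (hr : n * |m * α - r| < 1 - (2 * k - 2) * α) :
    ∃ s, IsSturmianOfSlope α s ∧ ∃ p, IsKAbelianPower k n m p ∧ OccursIn p s := by
  have hk' : (2 : ℝ) ≤ k := by exact_mod_cast hk
  have h1 : α < 1 := by nlinarith
  have hkα : (k : ℝ) * α ≤ 1 := by nlinarith
  set η := m * α - r with hη
  -- All `n + 1` boundary points must fit into the free interval; its left end is the first or the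
  -- last of them according to the sign of `η`.
  obtain ⟨x, hx⟩ : ∃ x : ℝ, ∀ j : ℕ, j ≤ n →
      (k - 1) * α ≤ x + j * η ∧ x + j * η < 1 - (k - 1) * α := by
    rcases le_total 0 η with hs | hs
    · rw [abs_of_nonneg hs] at hr
      refine ⟨(k - 1) * α, fun j hj => ?_⟩
      have : (j : ℝ) * η ≤ n * η := by gcongr
      have : 0 ≤ (j : ℝ) * η := by positivity
      constructor <;> linarith
    · rw [abs_of_nonpos hs] at hr
      refine ⟨(k - 1) * α - n * η, fun j hj => ?_⟩
      have : (j : ℝ) * -η ≤ n * -η := by gcongr; linarith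
      have : 0 ≤ (j : ℝ) * -η := mul_nonneg (by positivity) (by linarith)
      constructor <;> linarith
  have hpos : 0 ≤ (k - 1 : ℝ) * α := by nlinarith
  -- A shift by fewer than `k` letters leaves the floor unchanged, so no 1 lies among the `k - 1`
  -- letters on either side of a boundary.
  have hF : ∀ j ≤ n, ∀ z : ℝ, |z| ≤ (k - 1) * α → ⌊x + (j * m : ℕ) * α + z⌋ = j * r := by
    intro j hj z hz
    obtain ⟨z1, z2⟩ := abs_le.1 hz
    have := hx j hj
    rw [Int.floor_eq_iff]
    have e : x + (j * m : ℕ) * α + z = j * r + (x + j * η + z) := by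
      rw [hη]; push_cast; ring
    rw [e]; push_cast
    constructor <;> linarith
  have hcs := countsSparse_sturmianLower h0 h1 hkα x
  set F : ℕ → ℤ := fun n => ⌊x + n * α⌋ with hFdef
  have hF0 : ∀ j ≤ n, ∀ t < k, F (j * m + t) = j * r := by
    intro j hj t ht
    have ht' : (t : ℝ) ≤ k - 1 := by
      have : ((t + 1 : ℕ) : ℝ) ≤ k := by exact_mod_cast ht
      push_cast at this; linarith
    rw [← hF j hj (t * α) (by rw [abs_of_nonneg (by positivity)]; gcongr)]
    simp only [hFdef]; congr 1; push_cast; ring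
  have hF1 : ∀ j < n, ∀ t < k, F (j * m + m - t) = (j + 1) * r := by
    intro j hj t ht
    have ht' : (t : ℝ) ≤ k - 1 := by
      have : ((t + 1 : ℕ) : ℝ) ≤ k := by exact_mod_cast ht
      push_cast at this; linarith
    have := hF (j + 1) hj (-(t * α))
      (by rw [abs_neg, abs_of_nonneg (by positivity)]; gcongr)
    push_cast at this
    rw [← this]
    simp only [hFdef]; congr 1
    rw [Nat.cast_sub (by omega)]; push_cast; ring
  have hx0 := hx 0 (by omega)
  refine ⟨sturmianLower α x, ⟨x, ⟨?_, ?_⟩, Or.inl rfl⟩, block (sturmianLower α x) 0 (n * m),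
    ⟨hn, (List.range n).map fun j => block (sturmianLower α x) (0 + j * m) m, by simp, ?_, ?_,
      (flatten_map_block _ _ _ _).symm⟩, 0, ?_⟩
  · simp at hx0; linarith
  · simp at hx0; linarith
  · intro u hu
    obtain ⟨j, -, rfl⟩ := List.mem_map.1 hu
    simp
  · intro u hu v hv
    obtain ⟨j, hj, rfl⟩ := List.mem_map.1 hu
    obtain ⟨j', hj', rfl⟩ := List.mem_map.1 hv
    rw [List.mem_range] at hj hj'
    simp only [zero_add]
    have a0 := hF0 j hj.le 0 (by omega)
    have b0 := hF0 j' hj'.le 0 (by omega)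
    have a1 := hF1 j hj 0 (by omega)
    have b1 := hF1 j' hj' 0 (by omega)
    simp only [add_zero, Nat.sub_zero] at a0 a1 b0 b1
    refine hcs.kAbelianEquiv_block _ _ m hkm ?_ ?_ ?_ ?_ ?_
    · intro t ht; rw [hF0 j hj.le t ht, a0]
    · intro t ht; rw [hF1 j hj t ht, a1]
    · intro t ht; rw [hF0 j' hj'.le t ht, b0]
    · intro t ht; rw [hF1 j' hj' t ht, b1]
    · rw [a1, a0, b1, b0]; ring
  · simp [block]

/-! ### The critical exponent as a function of the approximation constant. -/

open Filter in
/-- The critical exponent of a small slope in terms of its approximation constant. -/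
theorem criticalExponent_eq {μ : ℝ} (hμ : 0 < μ) (h0 : 0 < α) (hk : 1 < k)
    (hα : (2 * k - 1 : ℝ) * α ≤ 1)
    (hlow : ∀ ε > 0, ∃ M : ℕ, ∀ m ≥ M, ∀ r : ℤ, μ - ε < m * |m * α - r|)
    (hup : ∀ ε > 0, ∀ M : ℕ, ∃ m ≥ M, ∃ r : ℤ, m * |m * α - r| < μ + ε) :
    criticalExponent k α = ENNReal.ofReal ((1 - (2 * k - 2) * α) / μ) := by
  have hk' : (2 : ℝ) ≤ k := by exact_mod_cast hk
  have h1 : α < 1 := by nlinarith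
  have hkα : (k : ℝ) * α ≤ 1 := by nlinarith
  set L := 1 - (2 * k - 2) * α with hL
  have hLpos : 0 < L := by rw [hL]; linarith
  apply le_antisymm
  · refine ENNReal.le_of_forall_pos_le_add fun ε hε _ => ?_
    set c : ℝ := L / μ + ε with hc
    have hε' : (0 : ℝ) < ε := hε
    have hcpos : 0 < c := by positivity
    rw [← ENNReal.ofReal_coe_nnreal, ← ENNReal.ofReal_add (by positivity) (by positivity), ← hc]
    have hcμ : L < c * μ := by
      rw [hc, add_mul, div_mul_cancel₀ _ hμ.ne']; nlinarith
    -- The tolerance makes `c * ν` the midpoint of `L` and `c * μ`; the margin above `L` absorbs the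
    -- loss of two blocks in `(n - 2) * ν ≤ m * L` once `m` is large.
    obtain ⟨M, hM⟩ := hlow ((c * μ - L) / (2 * c)) (by apply div_pos <;> linarith)
    set ν := μ - (c * μ - L) / (2 * c) with hν
    have hνc : c * ν = (c * μ + L) / 2 := by rw [hν]; field_simp; ring
    have hν0 : 0 < ν := by
      by_contra hneg
      have : c * ν ≤ 0 := mul_nonpos_of_nonneg_of_nonpos hcpos.le (not_lt.1 hneg)
      nlinarith [mul_pos hcpos hμ]
    obtain ⟨M', hM'⟩ := exists_nat_gt (4 * ν / (c * μ - L))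
    refine limsup_le_of_le (h := ?_)
    filter_upwards [eventually_ge_atTop (max M (max M' k))] with m hm
    have hm1 : M ≤ m := (le_max_left _ _).trans hm
    have hm2 : M' ≤ m := (le_max_left _ _).trans ((le_max_right _ _).trans hm)
    have hm3 : k ≤ m := (le_max_right _ _).trans ((le_max_right _ _).trans hm)
    have hmpos : (0 : ℝ) < m := by exact_mod_cast (by omega : 0 < m)
    have hmM : 4 * ν < m * (c * μ - L) := by
      rw [← div_lt_iff₀ (by linarith)]
      exact hM'.trans_le (by exact_mod_cast hm2)
    have hle : maxExponent k α m ≤ (⌊c * m⌋₊ : ℕ∞) := by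
      refine sSup_le ?_
      rintro e ⟨n, rfl, s, hs, p, hp, ho⟩
      obtain ⟨x, F, hF, hF'⟩ := exists_countsSparse h0 h1 hkα hs
      obtain ⟨r, hr⟩ := hF.exponent_mul_le hk hα hF' hm3 hp ho
      have hm4 := hM m hm1 r
      have hn2 : (0 : ℝ) ≤ (n : ℝ) - 2 := by
        have : (2 : ℝ) ≤ n := by exact_mod_cast hp.1
        linarith
      have hb : ((n : ℝ) - 2) * ν ≤ m * L := by
        calc ((n : ℝ) - 2) * ν ≤ ((n : ℝ) - 2) * (m * |m * α - r|) := by gcongr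
          _ = m * (((n : ℝ) - 2) * |m * α - r|) := by ring
          _ ≤ m * L := by gcongr
      have : (n : ℝ) ≤ c * m := by
        refine le_of_mul_le_mul_right ?_ hν0
        have : c * m * ν = m * ((c * μ + L) / 2) := by rw [← hνc]; ring
        linarith
      exact_mod_cast Nat.le_floor this
    have hle' : (maxExponent k α m : ENNReal) ≤ ENNReal.ofReal (c * m) := by
      calc (maxExponent k α m : ENNReal) ≤ ((⌊c * m⌋₊ : ℕ∞) : ENNReal) := by
            exact_mod_cast hle
        _ = ENNReal.ofReal (⌊c * m⌋₊ : ℝ) := by simp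
        _ ≤ _ := ENNReal.ofReal_le_ofReal (Nat.floor_le (by positivity))
    refine ENNReal.div_le_of_le_mul (hle'.trans_eq ?_)
    rw [ENNReal.ofReal_mul hcpos.le, ENNReal.ofReal_natCast]
  · refine ENNReal.le_of_forall_pos_le_add fun ε hε _ => ?_
    rw [← tsub_le_iff_right]
    have hε' : (0 : ℝ) < ε := hε
    rw [← ENNReal.ofReal_coe_nnreal, ← ENNReal.ofReal_sub _ hε'.le]
    set c : ℝ := L / μ - ε with hc
    rcases le_or_gt c 0 with hc0 | hc0
    · rw [ENNReal.ofReal_of_nonpos hc0]; exact zero_le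
    have hcμ : c * μ < L := by
      rw [hc, sub_mul, div_mul_cancel₀ _ hμ.ne']; nlinarith
    refine le_limsup_of_frequently_le (frequently_atTop.2 fun M => ?_)
    -- Chosen so that `c * (μ + δ) + δ < L`; the second `δ` pays for rounding `c * m` up to an
    -- integer exponent.
    set δ := (L - c * μ) / (2 * c + 2) with hδ
    have hδ0 : 0 < δ := by apply div_pos <;> linarith
    have hδc : δ * (2 * c + 2) = L - c * μ := by rw [hδ]; field_simp
    obtain ⟨M', hM'⟩ := exists_nat_gt ((μ + δ) / δ)
    obtain ⟨M'', hM''⟩ := exists_nat_gt (1 / c)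
    obtain ⟨m, hm, r, hr⟩ := hup δ hδ0 (max (max M M'') (max M' k))
    have hm1 : M ≤ m := (le_max_left _ _).trans ((le_max_left _ _).trans hm)
    have hm4 : M'' ≤ m := (le_max_right _ _).trans ((le_max_left _ _).trans hm)
    have hm2 : M' ≤ m := (le_max_left _ _).trans ((le_max_right _ _).trans hm)
    have hm3 : k ≤ m := (le_max_right _ _).trans ((le_max_right _ _).trans hm)
    have hmpos : (0 : ℝ) < m := by exact_mod_cast (by omega : 0 < m)
    have hmM : μ + δ < m * δ := by
      rw [← div_lt_iff₀ hδ0]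
      exact hM'.trans_le (by exact_mod_cast hm2)
    have hcm : 1 < m * c := by
      rw [← div_lt_iff₀ hc0]
      exact hM''.trans_le (by exact_mod_cast hm4)
    refine ⟨m, hm1, ?_⟩
    have hn : 2 ≤ ⌈c * m⌉₊ := by
      rw [Nat.succ_le_iff, Nat.lt_ceil]; push_cast; linarith
    have hη : |m * α - r| < δ := by
      refine lt_of_mul_lt_mul_left (hr.trans hmM) hmpos.le
    obtain ⟨s, hs, p, hp⟩ := exists_kAbelianPower h0 hk hα hn hm3 r (by
      have h3 := (Nat.ceil_lt_add_one (by positivity : 0 ≤ c * m)).le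
      calc (⌈c * m⌉₊ : ℝ) * |m * α - r| ≤ (c * m + 1) * |m * α - r| := by gcongr
        _ = c * (m * |m * α - r|) + |m * α - r| := by ring
        _ < c * (μ + δ) + δ := by gcongr
        _ < L := by nlinarith)
    have hle : ((⌈c * m⌉₊ : ℕ) : ℕ∞) ≤ maxExponent k α m :=
      le_sSup ⟨_, rfl, s, hs, p, hp⟩
    have hle' : ENNReal.ofReal (c * m) ≤ (maxExponent k α m : ENNReal) := by
      calc ENNReal.ofReal (c * m) ≤ ENNReal.ofReal (⌈c * m⌉₊ : ℝ) :=
            ENNReal.ofReal_le_ofReal (Nat.le_ceil _)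
        _ = ((⌈c * m⌉₊ : ℕ∞) : ENNReal) := by simp
        _ ≤ _ := by exact_mod_cast hle
    rw [ENNReal.le_div_iff_mul_le (Or.inl (by simpa using hmpos.ne')) (Or.inl (by simp))]
    rwa [ENNReal.ofReal_mul hc0.le, ENNReal.ofReal_natCast] at hle'

end Slopes

/-! ### A dense set of slopes with approximation constant `1 / √(N² + 4)`. -/

section Approximation

variable {α w K : ℝ}

/-- Since `|g| ≥ 1`, the product `m|η|` is at least `1/w - |K|η²`. If it is below `1/w`, then `η` is
small and the error term is negligible for large `m`. -/
lemma exists_lt_mul_abs_sub (hw : 0 < w)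
    (H : ∀ p q : ℤ, q ≠ 0 → ∃ g : ℤ, g ≠ 0 ∧ q * (q * α - p) = -g / w + K * (q * α - p) ^ 2)
    {ε : ℝ} (hε : 0 < ε) :
    ∃ M : ℕ, ∀ m ≥ M, ∀ r : ℤ, 1 / w - ε < m * |m * α - r| := by
  obtain ⟨M, hM⟩ := exists_nat_gt (|K| / (w ^ 2 * ε))
  refine ⟨max M 1, fun m hm r => ?_⟩
  have hm1 : (1 : ℝ) ≤ m := by exact_mod_cast (le_max_right _ _).trans hm
  have hmM : |K| < m * (w ^ 2 * ε) := by
    rw [← div_lt_iff₀ (by positivity)]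
    exact hM.trans_le (by exact_mod_cast (le_max_left _ _).trans hm)
  obtain ⟨g, hg, e⟩ := H r m (by have : 1 ≤ m := (le_max_right _ _).trans hm; omega)
  simp only [Int.cast_natCast] at e
  set η := m * α - r
  have hg1 : (1 : ℝ) ≤ |(g : ℝ)| := by exact_mod_cast Int.one_le_abs hg
  have hge : 1 / w - |K| * η ^ 2 ≤ m * |η| := by
    have e1 : (g : ℝ) / w = K * η ^ 2 - m * η := by rw [e]; ring
    have e2 : |(g : ℝ) / w| ≤ |K * η ^ 2| + |m * η| := by rw [e1]; exact abs_sub _ _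
    rw [abs_div, abs_mul, abs_mul, abs_of_pos hw, abs_of_nonneg (sq_nonneg η),
      abs_of_nonneg (by positivity : (0 : ℝ) ≤ m)] at e2
    have : 1 / w ≤ |(g : ℝ)| / w := by gcongr
    linarith
  rcases le_or_gt (1 / w) (m * |η|) with h | h
  · linarith
  · have h2 : |K| * η ^ 2 < ε := by
      have h3 : w * (m * |η|) < 1 := by rwa [lt_div_iff₀' hw] at h
      have h4 : (w * (m * |η|)) ^ 2 ≤ 1 := pow_le_one₀ (by positivity) h3.le
      have h5 : w ^ 2 * m * η ^ 2 ≤ 1 := by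
        calc w ^ 2 * m * η ^ 2 ≤ w ^ 2 * (m * m) * η ^ 2 := by gcongr; nlinarith
          _ = (w * (m * |η|)) ^ 2 := by rw [← sq_abs η]; ring
          _ ≤ 1 := h4
      rcases eq_or_ne η 0 with h0 | h0
      · simpa [h0] using hε
      · have : 0 < η ^ 2 := by positivity
        calc |K| * η ^ 2 < m * (w ^ 2 * ε) * η ^ 2 := by gcongr
          _ = (w ^ 2 * m * η ^ 2) * ε := by ring
          _ ≤ 1 * ε := by gcongr
          _ = ε := one_mul ε
    linarith

lemma exists_mul_abs_sub_lt (hw : 0 < w)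
    (H : ∀ δ > 0, ∃ p q g : ℤ, |g| = 1 ∧ |q * α - p| < δ ∧
      q * (q * α - p) = -g / w + K * (q * α - p) ^ 2)
    {ε : ℝ} (hε : 0 < ε) (M : ℕ) : ∃ m ≥ M, ∃ r : ℤ, m * |m * α - r| < 1 / w + ε := by
  -- The bound `1` gives `η² ≤ |η|`, the bound with `ε` makes the error term less than `ε`, and the
  -- one with `1 / (2w)` forces `|q| ≥ M`.
  obtain ⟨p, q, g, hg, hη, e⟩ :=
    H (min 1 (min ε (1 / (2 * w)) / (|K| + M + 1))) (by positivity)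
  set η := q * α - p with hηdef
  have h1 := hη.trans_le (min_le_left _ _)
  have h2 := hη.trans_le (min_le_right _ _)
  rw [lt_div_iff₀ (by positivity)] at h2
  have h3 := h2.trans_le (min_le_left _ _)
  have h4 := h2.trans_le (min_le_right _ _)
  have hη0 := abs_nonneg η
  have hK : |K * η ^ 2| ≤ |K| * |η| := by
    rw [abs_mul, ← sq_abs η, abs_of_nonneg (sq_nonneg |η|), sq]
    gcongr
    nlinarith
  have hM0 : 0 ≤ |η| * M := by positivity
  have hK0 : 0 ≤ |K| * |η| := by positivity
  have hgw : |-(g : ℝ) / w| = 1 / w := by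
    rw [abs_div, abs_neg, abs_of_pos hw, ← Int.cast_abs, hg, Int.cast_one]
  have hqη : |(q : ℝ)| * |η| = |-(g : ℝ) / w + K * η ^ 2| := by rw [← abs_mul, e]
  have hnat : ((q.natAbs : ℕ) : ℝ) = |(q : ℝ)| := by
    rw [Nat.cast_natAbs, Int.cast_abs]
  refine ⟨q.natAbs, ?_, q.sign * p, ?_⟩
  · have e1 := abs_sub_abs_le_abs_add (-(g : ℝ) / w) (K * η ^ 2)
    rw [hgw, ← hqη] at e1
    have e2 : 1 / w = 1 / (2 * w) + 1 / (2 * w) := by field_simp; norm_num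
    have : M * |η| ≤ |(q : ℝ)| * |η| := by nlinarith
    have hpos : 0 < |η| := by
      rcases hη0.eq_or_lt with h0 | h0
      · rw [← h0] at e1 hK
        have : 0 < 1 / w := by positivity
        linarith
      · exact h0
    have := le_of_mul_le_mul_right this hpos
    rw [← hnat] at this
    exact_mod_cast this
  · have e3 : |(q.natAbs : ℝ) * α - (q.sign * p : ℤ)| = |η| := by
      rcases lt_trichotomy q 0 with hq | hq | hq
      · rw [hnat, Int.sign_eq_neg_one_of_neg hq, abs_of_neg (Int.cast_lt_zero.2 hq : (q : ℝ) < 0),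
          ← abs_neg η, hηdef]
        congr 1; push_cast; ring
      · have e1 := abs_sub_abs_le_abs_add (-(g : ℝ) / w) (K * η ^ 2)
        rw [hgw, ← hqη, hq] at e1
        have e2 : 1 / w = 1 / (2 * w) + 1 / (2 * w) := by field_simp; norm_num
        have : 0 < 1 / (2 * w) := by positivity
        simp only [Int.cast_zero, abs_zero, zero_mul] at e1
        linarith
      · rw [hnat, Int.sign_eq_one_of_pos hq, abs_of_pos (Int.cast_pos.2 hq : (0 : ℝ) < q), hηdef]
        simp
    rw [e3, hnat, hqη]
    have := abs_add_le (-(g : ℝ) / w) (K * η ^ 2)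
    rw [hgw] at this
    linarith

/-- `N² + 4` is not a square. -/
lemma quadraticForm_ne_zero {N : ℕ} (hN : 1 ≤ N) {u v : ℤ} (h : u ≠ 0 ∨ v ≠ 0) :
    u ^ 2 + N * u * v - v ^ 2 ≠ 0 := by
  intro h0
  have hv : v ≠ 0 := by
    rintro rfl
    simp at h0 h
    exact h h0
  have e : (2 * u + N * v) ^ 2 = ((N : ℤ) ^ 2 + 4) * v ^ 2 := by linear_combination 4 * h0
  have hd : v ∣ 2 * u + N * v := (Int.pow_dvd_pow_iff two_ne_zero).1 (e ▸ Dvd.intro_left _ rfl)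
  obtain ⟨z, hz⟩ := hd
  rw [hz, mul_pow, mul_comm] at e
  have e2 : z ^ 2 = (N : ℤ) ^ 2 + 4 := mul_right_cancel₀ (pow_ne_zero 2 hv) e
  rw [← sq_abs] at e2
  have hz0 := abs_nonneg z
  have hN' : (1 : ℤ) ≤ N := by exact_mod_cast hN
  have l1 : (N : ℤ) < |z| := by nlinarith
  -- For `N ≥ 2`, `N² + 4` lies strictly between `N²` and `(N + 1)²`; for `N = 1` it is 5.
  rcases hN.eq_or_lt with h1 | h1
  · rw [← h1] at e2 l1
    have : |z| < 3 := by nlinarith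
    have : |z| = 2 := by push_cast at l1; omega
    rw [this] at e2; norm_num at e2
  · have h1' : (2 : ℤ) ≤ N := by exact_mod_cast h1
    nlinarith

/-- The quadratic form is the norm form of `ℤ[θ]`, and `θ` is a unit of norm `-1`. The powers of `θ`
supply arbitrarily good approximations with `|g| = 1`. -/
lemma exists_pow_eq {N : ℕ} {θ : ℝ} (hθ : θ ^ 2 + N * θ = 1) (n : ℕ) :
    ∃ u v : ℤ, u + v * θ = θ ^ n ∧ |u ^ 2 - N * u * v - v ^ 2| = 1 := by
  induction n with
  | zero => exact ⟨1, 0, by simp, by simp⟩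
  | succ n ih =>
    obtain ⟨u, v, h, h'⟩ := ih
    refine ⟨v, u - N * v, ?_, ?_⟩
    · rw [pow_succ, ← h]; push_cast; linear_combination (-(v : ℝ)) * hθ
    · rw [← h', ← abs_neg]; congr 1; ring

/-- Slopes with approximation constant `1 / √(N² + 4)` are dense. -/
lemma exists_slope {N : ℕ} (hN : 1 ≤ N) {x y : ℝ} (hxy : x < y) :
    ∃ α : ℝ, x < α ∧ α < y ∧ Irrational α ∧
      (∀ ε > 0, ∃ M : ℕ, ∀ m ≥ M, ∀ r : ℤ, 1 / √(N ^ 2 + 4) - ε < m * |m * α - r|) ∧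
      (∀ ε > 0, ∀ M : ℕ, ∃ m ≥ M, ∃ r : ℤ, m * |m * α - r| < 1 / √(N ^ 2 + 4) + ε) := by
  set w := √((N : ℝ) ^ 2 + 4) with hw
  have hw2 : w ^ 2 = (N : ℝ) ^ 2 + 4 := Real.sq_sqrt (by positivity)
  have hw0 : 0 < w := by positivity
  obtain ⟨z, hz1, hz2⟩ := exists_rat_btwn hxy
  set a := z.num
  set c : ℤ := (z.den : ℤ) with hc
  have hc1 : (1 : ℤ) ≤ c := by have := z.pos; omega
  have hc1' : (1 : ℝ) ≤ c := by exact_mod_cast hc1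
  have hcop : IsCoprime a c := by
    rw [Int.isCoprime_iff_gcd_eq_one]; exact z.reduced
  obtain ⟨d, b', hdet'⟩ := hcop
  obtain ⟨b, rfl⟩ : ∃ b, b' = -b := ⟨-b', by simp⟩
  have hdet : a * d - b * c = 1 := by linarith
  have hdetR : (a : ℝ) * d - b * c = 1 := by exact_mod_cast hdet
  have hzac : (z : ℝ) = a / c := by
    rw [hc]; exact_mod_cast (Rat.cast_def z : (z : ℝ) = _)
  set θ := (w - N) / 2 with hθdef
  have hθ : θ ^ 2 + N * θ = 1 := by rw [hθdef]; linear_combination hw2 / 4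
  have hN' : (1 : ℝ) ≤ N := by exact_mod_cast hN
  have hθ0 : 0 < θ := by rw [hθdef]; nlinarith
  have hθ1 : θ < 1 := by nlinarith
  -- Translating `θ` by a large integer pushes its image under the unimodular matrix with first
  -- column `(a, c)` towards `a / c = z`, at distance `1 / (c * ρ)`.
  obtain ⟨n₀, hn₀⟩ := exists_nat_gt (1 / min (z - x) (y - z) - d)
  have hmin : 0 < min ((z : ℝ) - x) (y - z) := lt_min (by linarith) (by linarith)
  set τ := θ + n₀ with hτ
  have hden : 1 / min ((z : ℝ) - x) (y - z) < c * τ + d := by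
    have : (n₀ : ℝ) ≤ c * τ := by rw [hτ]; nlinarith [(Nat.cast_nonneg n₀ : (0 : ℝ) ≤ n₀)]
    linarith
  set ρ := c * τ + d with hρ
  have hρ0 : 0 < ρ := lt_trans (by positivity) hden
  set α := (a * τ + b) / ρ with hα
  have hαρ : α * ρ = a * τ + b := div_mul_cancel₀ _ hρ0.ne'
  have hαz : z - α = 1 / (c * ρ) := by
    rw [hzac, hα]; field_simp; linear_combination a * hρ + hdetR
  have hlt : 1 / (c * ρ) < min ((z : ℝ) - x) (y - z) := by
    rw [div_lt_comm₀ (by positivity) hmin]; nlinarith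
  have hpos : 0 < 1 / (c * ρ) := by positivity
  set K := ρ ^ 2 * (1 / w - c / ρ) with hK
  -- In the coordinates `(u, v)` the error `qα - p` is `-(u - θv)/ρ`, and the form factors as `(u -
  -- θv)(u - θv + wv)`. Expressing `q` through `v` and `u - θv` leaves only a square of the error
  -- besides `-g/w`.
  have key : ∀ p q u v : ℤ, u = d * p - b * q - n₀ * (a * q - c * p) → v = a * q - c * p →
      q * (q * α - p) = -((u ^ 2 + N * u * v - v ^ 2 : ℤ) : ℝ) / w + K * (q * α - p) ^ 2 := by
    rintro p q u v hu hv
    have hu' : (u : ℝ) = d * p - b * q - n₀ * (a * q - c * p) := by rw [hu]; push_cast; ring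
    have hv' : (v : ℝ) = a * q - c * p := by rw [hv]; push_cast; ring
    have hN2 : (N : ℝ) = w - 2 * θ := by rw [hθdef]; ring
    have he : ρ * (q * α - p) = -(u - θ * v) := by
      rw [hu', hv']; linear_combination (q : ℝ) * hαρ - p * hρ + (a * q - c * p : ℝ) * hτ
    have hq : (q : ℝ) = ρ * v + c * (u - θ * v) := by
      rw [hu', hv', hρ, hτ]; linear_combination (-(q : ℝ)) * hdetR
    have hg : ((u ^ 2 + N * u * v - v ^ 2 : ℤ) : ℝ) = (u - θ * v) * (u - θ * v + w * v) := by
      push_cast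
      linear_combination (v : ℝ) ^ 2 * hθ + (u * v - θ * v ^ 2 : ℝ) * hN2
    have hη : q * α - p = -(u - θ * v) / ρ := by rw [← he]; field_simp
    rw [hg, hη, hK]
    nth_rewrite 1 [hq]
    field_simp
    ring
  have H1 : ∀ p q : ℤ, q ≠ 0 →
      ∃ g : ℤ, g ≠ 0 ∧ q * (q * α - p) = -g / w + K * (q * α - p) ^ 2 := by
    intro p q hq
    refine ⟨_, quadraticForm_ne_zero hN ?_, key p q _ _ rfl rfl⟩
    by_contra! h
    obtain ⟨h1, h2⟩ := h
    apply hq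
    linear_combination c * h1 + (c * n₀ + d) * h2 - q * hdet
  have H2 : ∀ δ > 0, ∃ p q g : ℤ, |g| = 1 ∧ |q * α - p| < δ ∧
      q * (q * α - p) = -g / w + K * (q * α - p) ^ 2 := by
    intro δ hδ
    obtain ⟨n, hn⟩ := exists_pow_lt_of_lt_one (mul_pos hδ hρ0) hθ1
    obtain ⟨u, v, h1, h2⟩ := exists_pow_eq hθ n
    -- The preimage of `(u, -v)` under the unimodular change of coordinates; its error is `θ ^ n /
    -- ρ` in absolute value.
    refine ⟨a * (u - n₀ * v) - b * v, c * (u - n₀ * v) - d * v, _, ?_, ?_,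
      key _ _ u (-v) ?_ ?_⟩
    · rw [← h2]; congr 1; ring
    · rw [← mul_lt_mul_iff_left₀ hρ0, ← abs_of_pos hρ0, ← abs_mul, abs_of_pos hρ0]
      refine lt_of_eq_of_lt ?_ hn
      rw [← h1, ← abs_of_pos (h1 ▸ pow_pos hθ0 n : 0 < u + v * θ), ← abs_neg]
      congr 1
      push_cast
      linear_combination (-(c * (u - n₀ * v) - d * v : ℝ)) * hαρ +
        (a * (u - n₀ * v) - b * v : ℝ) * hρ + (u + v * θ) * hdetR + v * hτ
    · linear_combination (-u) * hdet
    · linear_combination v * hdet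
  refine ⟨α, ?_, ?_, ?_, fun ε hε => exists_lt_mul_abs_sub hw0 H1 hε,
    fun ε hε => exists_mul_abs_sub_lt hw0 H2 hε⟩
  · have := hlt.trans_le (min_le_left _ _); linarith
  · linarith
  -- A rational slope would have a vanishing error for some `q ≠ 0`, forcing `g = 0`.
  · rintro ⟨t, ht⟩
    obtain ⟨g, hg, e⟩ := H1 t.num t.den (by exact_mod_cast t.den_ne_zero)
    have h0 : ((t.den : ℤ) : ℝ) * α - t.num = 0 := by
      rw [← ht, Int.cast_natCast, ← Rat.cast_natCast, ← Rat.cast_mul, Rat.den_mul_eq_num]; simp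
    rw [h0] at e
    have e' : (g : ℝ) / w = 0 := by linear_combination e
    exact (div_eq_zero_iff.1 e').elim (fun h => hg (by exact_mod_cast h)) hw0.ne'

end Approximation

/-! ### Density of the spectrum. -/

theorem mainTheorem4 (k : ℕ) (hk : 1 < k) :
    Set.Ioi (√5 / (2 * (k : ℝ) - 1)) ⊆
      closure (kLagrangeSpectrum k ∩ Set.Ioi (√5 / (2 * (k : ℝ) - 1))) := by
  intro t ht
  have hk' : (2 : ℝ) ≤ k := by exact_mod_cast hk
  rw [Set.mem_Ioi, div_lt_iff₀ (by linarith)] at ht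
  have h5 : (0 : ℝ) < √5 := by positivity
  have ht0 : 0 < t := by
    by_contra hneg
    nlinarith [mul_nonneg (by linarith : (0 : ℝ) ≤ -t) (by linarith : (0 : ℝ) ≤ 2 * k - 1)]
  -- For `t ≥ √5` the choice `N = ⌊t⌋ + 1` works because `(t + 1)² + 4 < (3t)²` and `3 ≤ 2k - 1`.
  obtain ⟨N, hN, hN1, hN2⟩ : ∃ N : ℕ, 1 ≤ N ∧ √((N : ℝ) ^ 2 + 4) < t * (2 * k - 1) ∧
      t < √((N : ℝ) ^ 2 + 4) := by
    rcases lt_or_ge t √5 with h | h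
    · refine ⟨1, le_rfl, ?_, ?_⟩ <;> norm_num <;> assumption
    · have h2 : 2 ≤ t := le_trans (Real.le_sqrt_of_sq_le (by norm_num)) h
      have f1 := Nat.lt_floor_add_one t
      have f2 := Nat.floor_le ht0.le
      refine ⟨⌊t⌋₊ + 1, by omega, ?_, ?_⟩
      · rw [Real.sqrt_lt' (by nlinarith)]
        push_cast
        calc ((⌊t⌋₊ : ℝ) + 1) ^ 2 + 4 ≤ (t + 1) ^ 2 + 4 := by gcongr
          _ < (t * 3) ^ 2 := by nlinarith
          _ ≤ _ := by gcongr; linarith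
      · apply Real.lt_sqrt_of_sq_lt
        push_cast
        nlinarith
  set w := √((N : ℝ) ^ 2 + 4) with hw
  have hw0 : 0 < w := by positivity
  rw [Metric.mem_closure_iff]
  intro ε hε
  -- The slope at which `(1 - (2k - 2)α) * w` equals `t`. An admissible `α` just below it gives a
  -- value just above `t`, which stays in the open half-line, and keeps `(2k - 1)α ≤ 1`.
  set α₀ := (1 - t / w) / (2 * k - 2) with hα₀
  have hk2 : (0 : ℝ) < 2 * k - 2 := by linarith
  have hα₀' : α₀ * (2 * k - 2) = 1 - t / w := div_mul_cancel₀ _ hk2.ne'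
  have htw : t / w < 1 := (div_lt_one hw0).2 hN2
  have hα₀0 : 0 < α₀ := div_pos (by linarith) hk2
  obtain ⟨α, hα1, hα2, hirr, hlow, hup⟩ := exists_slope hN
    (show max 0 (α₀ - ε / ((2 * k - 2) * w)) < α₀ from
      max_lt hα₀0 (sub_lt_self _ (by positivity)))
  obtain ⟨hα0, hα3⟩ := max_lt_iff.1 hα1
  have h1tw : 1 < t / w * (2 * k - 1) := by
    rw [div_mul_eq_mul_div, lt_div_iff₀ hw0]; linarith
  have hα4 : (2 * k - 1 : ℝ) * α ≤ 1 := by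
    have : (2 * k - 1 : ℝ) * α₀ < 1 := by
      rw [hα₀, mul_div_assoc', div_lt_one hk2]; linarith
    nlinarith
  have hc := criticalExponent_eq (by positivity) hα0 hk hα4 hlow hup
  rw [← hw, div_div_eq_mul_div, div_one] at hc
  set y := (1 - (2 * k - 2) * α) * w with hy
  have hty : t < y := by
    have : t / w < 1 - (2 * k - 2) * α := by nlinarith
    rwa [div_lt_iff₀ hw0] at this
  have hyt : y < t + ε := by
    have e : ε / ((2 * k - 2) * w) * ((2 * k - 2) * w) = ε :=
      div_mul_cancel₀ _ (by positivity)
    have h3 : (α₀ - ε / ((2 * k - 2) * w)) * ((2 * k - 2) * w) < α * ((2 * k - 2) * w) := by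
      gcongr
    have e2 : α₀ * (2 * k - 2) * w = w - t := by rw [hα₀']; field_simp
    rw [hy]
    linarith
  refine ⟨y, ⟨⟨α, hirr, ?_, ?_⟩, ?_⟩, ?_⟩
  · rw [hc]; exact ENNReal.ofReal_ne_top
  · rw [hc, ENNReal.toReal_ofReal (by linarith)]
  · rw [Set.mem_Ioi, div_lt_iff₀ (by linarith)]
    nlinarith
  · rw [Real.dist_eq, abs_sub_lt_iff]
    constructor <;> linarith
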